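/- Let $(X,E(X))$ be a connected, locally finite, non-oriented graph, and let $P=(p(x,y))_{x,y\in X}$ be a stochastic matrix that is adapted to it, i.e. for all distinct $x,y\in X$ one has $p(x,y)>0$ if and only if $x$ and $y$ are joined by an edge (loops are disregarded: $p(x,x)\ge 0$ is arbitrary). For the random walk $(X,P)$ let $p^{(n)}(x,y)$ ($n\ge 0$) be the $n$-step transition probabilities, let $f^{(n)}(x,y)$ ($n\ge1$) be the probability that the walk started at $x$ hits $y$ for the first time after $n$ steps (the starting time not counted as a hit), and let $G(x,y|z)=\sum_{n\ge0}p^{(n)}(x,y)z^n$. Then the radius of convergence $r$ of the power series $G(x,x|z)$ does not depend on $x\in X$. Moreover, if at least one of the following conditions holds, then the series $F(x,x)=\sum_{n\ge1}f^{(n)}(x,x)$ is totally convergent with respect to $x$, that is, $\sum_{n\ge1}\sup_{x\in X}f^{(n)}(x,x)<\infty$. (i) There are a subset $\Gamma$ of the automorphism group $\mathrm{AUT}(X)$ of the graph and a finite set $X_0\subset X$ such that for every $y\in X$ there exist $x\in X_0$ and $\gamma\in\Gamma$ with $\gamma(x)=y$, and $P$ is $\Gamma$-invariant, i.e. $p(\gamma(x),\gamma(y))=p(x,y)$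 for all $\gamma\in\Gamma$ and $x,y\in X$. (ii) $r>1$. (iii) $(X,P)$ is reversible, i.e. there is $m:X\to(0,\infty)$ such that $a(x,y):=m(x)p(x,y)$ satisfies $a(x,y)=a(y,x)$ for all $x,y\in X$, and it satisfies the strong isoperimetric inequality $$\sup_{A}\frac{m(A)}{s(A)}<+\infty ,\qquad m(A):=\sum_{x\in A}m(x),\quad s(A):=\sum_{x\in A,\;y\in X\setminus A}a(x,y),$$ where the supremum is over the non-empty finite subsets $A$ of $X$ and the quotient is $+\infty$ if $s(A)=0$. -/

import Mathlib

open scoped ENNReal NNReal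

namespace GraphWalk

variable {X : Type*}

/-- A random walk on `X` is given by its transition probabilities `p(x,y) = P x y`, each row being
a probability distribution. `pathProb P w` is the probability that the walk, started at `w 0`,
makes its first `n` steps along `w 0, w 1, …, w n`. -/
noncomputable def pathProb (P : X → PMF X) {n : ℕ} (w : Fin (n + 1) → X) : ℝ≥0∞ :=
  ∏ i : Fin n, P (w i.castSucc) (w i.succ)

/-- `p^(n)(x,y)`: the probability that the walk started at `x` is at `y` after `n` steps. -/
noncomputable def stepProb (P : X → PMF X) (n : ℕ) (x y : X) : ℝ≥0∞ :=
  ∑' w : {w : Fin (n + 1) → X // w 0 = x ∧ w (Fin.last n) = y}, pathProb P w.1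

/-- `f^(n)(x,y)` for `n ≥ 1`: the probability that the walk started at `x` hits `y` for the first
time (after time `0`) at time `n`. -/
noncomputable def firstProb (P : X → PMF X) (n : ℕ) (x y : X) : ℝ≥0∞ :=
  ∑' w : {w : Fin (n + 1) → X // w 0 = x ∧ w (Fin.last n) = y ∧
    ∀ i, i ≠ 0 → i ≠ Fin.last n → w i ≠ y}, pathProb P w.1

/-- The Green function `G(x,y|z) = ∑_{n ≥ 0} p^(n)(x,y) z^n` as a power series in `z ∈ ℂ`. -/
noncomputable def greenSeries (P : X → PMF X) (x y : X) : FormalMultilinearSeries ℂ ℂ ℂ :=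
  FormalMultilinearSeries.ofScalars ℂ fun n => ((stepProb P n x y).toReal : ℂ)

/-- The series `F(x,x) = ∑_{n ≥ 1} f^(n)(x,x)` converges totally with respect to `x`:
`∑_{n ≥ 1} sup_x f^(n)(x,x) < ∞`. -/
def ReturnSeriesTotallyConvergent (P : X → PMF X) : Prop :=
  (∑' n : ℕ, ⨆ x : X, firstProb P (n + 1) x x) < ⊤

/-- The walk is adapted to the graph: distinct `x`, `y` are joined by an edge iff `p(x,y) > 0`.
Loops are not recorded by `G`, and `p(x,x)` is unrestricted. -/
def Adapted (P : X → PMF X) (G : SimpleGraph X) : Prop :=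
  ∀ x y : X, x ≠ y → (0 < P x y ↔ G.Adj x y)

/-- `P` is invariant under each element of the set `Γ` of graph automorphisms. -/
def Invariant (P : X → PMF X) {G : SimpleGraph X} (Γ : Set (G ≃g G)) : Prop :=
  ∀ γ ∈ Γ, ∀ x y : X, P (γ x) (γ y) = P x y

/-- `a(x,y) = m(x) p(x,y)`. -/
noncomputable def conductance (P : X → PMF X) (m : X → ℝ≥0) (x y : X) : ℝ≥0∞ :=
  (m x : ℝ≥0∞) * P x y

/-- `m` is a reversibility measure for `P`: it is strictly positive and
`m(x) p(x,y) = m(y) p(y,x)`. -/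
def IsReversibilityMeasure (P : X → PMF X) (m : X → ℝ≥0) : Prop :=
  (∀ x, 0 < m x) ∧ ∀ x y, conductance P m x y = conductance P m y x

/-- `s(A) = ∑_{x ∈ A, y ∉ A} a(x,y)`. -/
noncomputable def boundaryWeight (P : X → PMF X) (m : X → ℝ≥0) (A : Finset X) : ℝ≥0∞ :=
  ∑ x ∈ A, ∑' y : {y : X // y ∉ A}, conductance P m x y

/-- The strong isoperimetric inequality `sup_A m(A) / s(A) < ∞`, over finite `A ⊆ X`. In `ℝ≥0∞` one
has `c / 0 = ∞` for `c ≠ 0`, while `0 / 0 = 0`, so that the empty set does not matter. -/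
def StrongIsoperimetric (P : X → PMF X) (m : X → ℝ≥0) : Prop :=
  (⨆ A : Finset X, (∑ x ∈ A, (m x : ℝ≥0∞)) / boundaryWeight P m A) < ⊤

end GraphWalk

open scoped ENNReal NNReal
namespace GraphWalk

variable {X : Type*}

/-! ### First-step decompositions -/

/-! Paths from `y` to `x`, around `x`, and back to `y` compare the return probabilities at the two
points up to constants, so connectedness makes the radius `r` common to all points.

Under (i), `f^(n)(x,x)` is constant on orbits, so its supremum is at most a sum over the finite set
`X₀`, and each return series sums to at most 1.

Under (ii), `p^(nk)(x,x) ≥ p^(n)(x,x)^k` improves any bound `p^(n)(x,x) s^n ≤ C_x` with `1 < s < r`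
to one with constant 1. This is uniform in `x`, and `f^(n) ≤ p^(n)` leaves a geometric series.

Condition (iii) implies (ii) by Cheeger's argument. Level sets and Cauchy–Schwarz (`cheeger_sq`)
bound the quadratic form of `P` by some `ρ < 1`. By polarization the operator norm has the same
bound (`norm_sq_le_of_numericalRange`), whence `p^(n)(x,x) ≤ ρ^n` and `r ≥ 1/ρ`. -/

theorem pathProb_cons (P : X → PMF X) {n : ℕ} (x : X) (w : Fin (n + 1) → X) :
    pathProb P (Fin.cons x w : Fin (n + 2) → X) = P x (w 0) * pathProb P w := by
  unfold pathProb
  rw [Fin.prod_univ_succ]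
  simp [Fin.castSucc_succ]

/-- Conditioning a sum over paths of length `n + 1` on the first step. -/
theorem tsum_pathProb_succ (P : X → PMF X) {n : ℕ} (x : X) (C : (Fin (n + 1) → X) → Prop)
    (D : (Fin (n + 2) → X) → Prop) (hD : ∀ w, D (Fin.cons x w) ↔ C w) :
    ∑' w : {w : Fin (n + 2) → X // w 0 = x ∧ D w}, pathProb P w.1 =
      ∑' z, P x z * ∑' w : {w : Fin (n + 1) → X // w 0 = z ∧ C w}, pathProb P w.1 := by
  classical
  have h1 : ∑' w : {w : Fin (n + 2) → X // w 0 = x ∧ D w}, pathProb P w.1 =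
      ∑' w : {w : Fin (n + 1) → X // C w}, P x (w.1 0) * pathProb P w.1 := by
    let e : {w : Fin (n + 1) → X // C w} ≃ {w : Fin (n + 2) → X // w 0 = x ∧ D w} :=
      { toFun := fun w => ⟨Fin.cons x w.1, by simp, (hD _).2 w.2⟩
        invFun := fun w => ⟨Fin.tail w.1, by
          obtain ⟨w, rfl, hw⟩ := w
          exact (hD _).1 ((Fin.cons_self_tail w).symm ▸ hw)⟩
        left_inv := fun w => by simp
        right_inv := fun w => by
          obtain ⟨w, rfl, hw⟩ := w
          exact Subtype.ext (Fin.cons_self_tail w) }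
    rw [← e.tsum_eq]
    exact tsum_congr fun w => pathProb_cons P x w.1
  let e : {w : Fin (n + 1) → X // C w} ≃ Σ z, {w : Fin (n + 1) → X // w 0 = z ∧ C w} :=
    { toFun := fun w => ⟨w.1 0, w.1, rfl, w.2⟩
      invFun := fun w => ⟨w.2.1, w.2.2.2⟩
      left_inv := fun w => rfl
      right_inv := by rintro ⟨z, w, rfl, h⟩; rfl }
  rw [h1, ← e.symm.tsum_eq, ENNReal.tsum_sigma']
  refine tsum_congr fun z => ?_
  rw [← ENNReal.tsum_mul_left]
  refine tsum_congr fun w => ?_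
  obtain ⟨w, rfl, h⟩ := w
  rfl

theorem stepProb_zero [DecidableEq X] (P : X → PMF X) (x y : X) :
    stepProb P 0 x y = if x = y then 1 else 0 := by
  unfold stepProb
  split_ifs with h
  · subst h
    have : Unique {w : Fin (0 + 1) → X // w 0 = x ∧ w (Fin.last 0) = x} :=
      { default := ⟨fun _ => x, rfl, rfl⟩
        uniq := fun w => Subtype.ext (funext fun i => by
          fin_cases i; exact w.2.1) }
    rw [tsum_eq_single default fun b hb => absurd (Unique.eq_default b) hb]
    simp [pathProb]
  · have : IsEmpty {w : Fin (0 + 1) → X // w 0 = x ∧ w (Fin.last 0) = y} :=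
      ⟨fun w => h (w.2.1.symm.trans w.2.2)⟩
    exact tsum_empty

theorem stepProb_succ (P : X → PMF X) (n : ℕ) (x y : X) :
    stepProb P (n + 1) x y = ∑' z, P x z * stepProb P n z y :=
  tsum_pathProb_succ P x (fun w => w (Fin.last n) = y) (fun w => w (Fin.last (n + 1)) = y)
    fun w => by rw [← Fin.succ_last, Fin.cons_succ]

theorem firstProb_one (P : X → PMF X) (x y : X) : firstProb P 1 x y = P x y := by
  unfold firstProb
  let : Unique {w : Fin (1 + 1) → X // w 0 = x ∧ w (Fin.last 1) = y ∧
      ∀ i, i ≠ 0 → i ≠ Fin.last 1 → w i ≠ y} :=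
    { default := ⟨![x, y], rfl, rfl, fun i h0 h1 => by fin_cases i <;> simp_all⟩
      uniq := fun w => Subtype.ext (funext fun i => by
        have h0 := w.2.1
        have h1 := w.2.2.1
        fin_cases i
        · exact h0
        · exact h1) }
  rw [tsum_eq_single default fun b hb => absurd (Unique.eq_default b) hb]
  simp only [pathProb, Finset.univ_unique, Finset.prod_singleton]
  rfl

theorem firstProb_succ (P : X → PMF X) (n : ℕ) (x y : X) :
    firstProb P (n + 2) x y =
      ∑' z, P x z * ({z | z ≠ y} : Set X).indicator (fun z => firstProb P (n + 1) z y) z := by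
  refine (tsum_pathProb_succ P x
    (fun w => w 0 ≠ y ∧ w (Fin.last (n + 1)) = y ∧ ∀ i, i ≠ 0 → i ≠ Fin.last (n + 1) → w i ≠ y)
    (fun w => w (Fin.last (n + 2)) = y ∧ ∀ i, i ≠ 0 → i ≠ Fin.last (n + 2) → w i ≠ y)
    fun w => ?_).trans (tsum_congr fun z => ?_)
  · rw [← Fin.succ_last, Fin.cons_succ]
    constructor
    · rintro ⟨h1, h2⟩
      refine ⟨?_, h1, fun i _ hi => ?_⟩
      · simpa using h2 (Fin.succ 0) (Fin.succ_ne_zero _)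
          (fun h => by simpa using congrArg Fin.val (Fin.succ_injective _ h))
      · simpa using h2 i.succ (Fin.succ_ne_zero _) fun h => hi (Fin.succ_injective _ h)
    · rintro ⟨h0, h1, h2⟩
      refine ⟨h1, fun i hi hl => ?_⟩
      obtain ⟨j, rfl⟩ := Fin.exists_succ_eq.2 hi
      rw [Fin.cons_succ]
      by_cases hj : j = 0
      · rwa [hj]
      · exact h2 j hj fun h => hl (by rw [h])
  · congr 1
    by_cases hz : z = y
    · have : IsEmpty {w : Fin (n + 1 + 1) → X // w 0 = z ∧ w 0 ≠ y ∧ w (Fin.last (n + 1)) = y ∧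
          ∀ i, i ≠ 0 → i ≠ Fin.last (n + 1) → w i ≠ y} :=
        ⟨fun w => w.2.2.1 (w.2.1.trans hz)⟩
      simp [hz]
    · rw [Set.indicator_of_mem (by exact hz)]
      unfold firstProb
      refine (Equiv.subtypeEquivRight fun w => ?_).tsum_eq
        (fun w : {w : Fin (n + 1 + 1) → X // w 0 = z ∧ w (Fin.last (n + 1)) = y ∧
          ∀ i, i ≠ 0 → i ≠ Fin.last (n + 1) → w i ≠ y} => pathProb P w.1)
      exact ⟨fun h => ⟨h.1, h.2.2⟩, fun h => ⟨h.1, h.1 ▸ hz, h.2⟩⟩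

/-! ### Elementary properties of the transition probabilities -/

theorem firstProb_le_stepProb (P : X → PMF X) (n : ℕ) (x y : X) :
    firstProb P n x y ≤ stepProb P n x y := by
  unfold firstProb stepProb
  exact ENNReal.tsum_comp_le_tsum_of_injective
    (f := fun w : {w : Fin (n + 1) → X // w 0 = x ∧ w (Fin.last n) = y ∧
      ∀ i, i ≠ 0 → i ≠ Fin.last n → w i ≠ y} =>
        (⟨w.1, w.2.1, w.2.2.1⟩ : {w : Fin (n + 1) → X // w 0 = x ∧ w (Fin.last n) = y}))
    (fun a b h => Subtype.ext (congrArg (fun w => w.1) h)) (fun w => pathProb P w.1)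

theorem stepProb_le_one (P : X → PMF X) (n : ℕ) (x y : X) : stepProb P n x y ≤ 1 := by
  classical
  induction n generalizing x with
  | zero => rw [stepProb_zero]; split_ifs <;> simp
  | succ n ih =>
    rw [stepProb_succ, ← (P x).tsum_coe]
    exact ENNReal.tsum_le_tsum fun z => mul_le_of_le_one_right' (ih z)

theorem stepProb_ne_top (P : X → PMF X) (n : ℕ) (x y : X) : stepProb P n x y ≠ ⊤ :=
  ((stepProb_le_one P n x y).trans_lt ENNReal.one_lt_top).ne

theorem stepProb_mul_le (P : X → PMF X) (n k : ℕ) (x z y : X) :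
    stepProb P n x z * stepProb P k z y ≤ stepProb P (n + k) x y := by
  classical
  induction n generalizing x with
  | zero =>
    rw [stepProb_zero, Nat.zero_add]
    split_ifs with h
    · rw [h, one_mul]
    · simp
  | succ n ih =>
    rw [Nat.succ_add, stepProb_succ, stepProb_succ, ← ENNReal.tsum_mul_right]
    refine ENNReal.tsum_le_tsum fun u => ?_
    rw [mul_assoc]
    gcongr
    exact ih u

theorem stepProb_pow_le (P : X → PMF X) (n k : ℕ) (x : X) :
    stepProb P n x x ^ k ≤ stepProb P (n * k) x x := by
  classical
  induction k with
  | zero => simp [stepProb_zero]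
  | succ k ih =>
    rw [pow_succ, Nat.mul_succ]
    exact (mul_le_mul_left ih _).trans (stepProb_mul_le P _ _ x x x)

theorem exists_stepProb_pos {G : SimpleGraph X} (hconn : G.Connected) {P : X → PMF X}
    (hP : Adapted P G) (x y : X) : ∃ n, stepProb P n x y ≠ 0 := by
  classical
  obtain ⟨w⟩ := hconn.preconnected x y
  induction w with
  | nil => exact ⟨0, by simp [stepProb_zero]⟩
  | @cons u v y h w ih =>
    obtain ⟨n, hn⟩ := ih
    refine ⟨n + 1, ?_⟩
    rw [stepProb_succ]
    intro h0
    exact mul_ne_zero ((hP u v h.ne).2 h).ne' hn (ENNReal.tsum_eq_zero.1 h0 v)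

/-- Induction on the horizon replaces disjointness of the hitting events: one step either lands on
`y` or leaves `N` further steps from some `z ≠ y`, and the row of `P` sums to 1. -/
theorem sum_firstProb_le_one (P : X → PMF X) (N : ℕ) (x y : X) :
    ∑ n ∈ Finset.range N, firstProb P (n + 1) x y ≤ 1 := by
  classical
  induction N generalizing x with
  | zero => simp
  | succ N ih =>
    rw [Finset.sum_range_succ', firstProb_one]
    simp_rw [firstProb_succ]
    rw [← Summable.tsum_finsetSum fun _ _ => ENNReal.summable]
    have hy : P x y = ∑' z, if z = y then P x z else 0 := by rw [tsum_ite_eq]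
    rw [hy, ← ENNReal.tsum_add, ← (P x).tsum_coe]
    refine ENNReal.tsum_le_tsum fun z => ?_
    by_cases hz : z = y
    · simp [hz]
    · have : ∀ n, ({z | z ≠ y} : Set X).indicator (fun z => firstProb P (n + 1) z y) z =
          firstProb P (n + 1) z y := fun n => Set.indicator_of_mem (by exact hz) _
      simp only [this, hz, if_false, add_zero, ← Finset.mul_sum]
      exact mul_le_of_le_one_right' (ih z)

theorem tsum_firstProb_le_one (P : X → PMF X) (x y : X) :
    ∑' n, firstProb P (n + 1) x y ≤ 1 :=
  ENNReal.tsum_le_of_sum_range_le fun N => sum_firstProb_le_one P N x y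

/-! ### Walks with quasi-transitive invariance -/

theorem firstProb_map (P : X → PMF X) (γ : X ≃ X) (hγ : ∀ x y, P (γ x) (γ y) = P x y) (n : ℕ)
    (x y : X) : firstProb P (n + 1) (γ x) (γ y) = firstProb P (n + 1) x y := by
  induction n generalizing x with
  | zero => simp only [Nat.zero_add, firstProb_one, hγ]
  | succ n ih =>
    rw [firstProb_succ, firstProb_succ, ← γ.tsum_eq]
    refine tsum_congr fun z => ?_
    rw [hγ]
    by_cases hz : z = y
    · simp [hz]
    · rw [Set.indicator_of_mem (by simpa using hz), Set.indicator_of_mem (by exact hz), ih]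

theorem totallyConvergent_of_invariant {G : SimpleGraph X} {P : X → PMF X} {Γ : Set (G ≃g G)}
    {X₀ : Set X} (hX₀ : X₀.Finite) (hcov : ∀ y : X, ∃ x ∈ X₀, ∃ γ ∈ Γ, γ x = y)
    (hΓ : Invariant P Γ) : ReturnSeriesTotallyConvergent P := by
  have h : ∀ n, ⨆ x, firstProb P (n + 1) x x ≤ ∑ x ∈ hX₀.toFinset, firstProb P (n + 1) x x := by
    refine fun n => iSup_le fun y => ?_
    obtain ⟨x, hx, γ, hγ, rfl⟩ := hcov y
    have := firstProb_map P γ.toEquiv (hΓ γ hγ) n x x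
    exact this.trans_le (Finset.single_le_sum (f := fun x => firstProb P (n + 1) x x)
      (fun _ _ => zero_le) (hX₀.mem_toFinset.2 hx))
  refine (ENNReal.tsum_le_tsum h).trans_lt ?_
  rw [Summable.tsum_finsetSum fun _ _ => ENNReal.summable]
  exact ENNReal.sum_lt_top.2 fun x _ => (tsum_firstProb_le_one P x x).trans_lt ENNReal.one_lt_top

/-! ### The radius of convergence of the Green function -/

theorem norm_greenSeries (P : X → PMF X) (x y : X) (n : ℕ) :
    ‖greenSeries P x y n‖ = (stepProb P n x y).toReal := by
  simp [greenSeries]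

theorem radius_le_radius {G : SimpleGraph X} (hconn : G.Connected) {P : X → PMF X}
    (hP : Adapted P G) (x y : X) : (greenSeries P y y).radius ≤ (greenSeries P x x).radius := by
  obtain ⟨i, hi⟩ := exists_stepProb_pos hconn hP y x
  obtain ⟨j, hj⟩ := exists_stepProb_pos hconn hP x y
  refine ENNReal.le_of_forall_nnreal_lt fun s hs => ?_
  rcases eq_or_ne s 0 with rfl | hs0
  · simp
  obtain ⟨C, hC, hb⟩ := (greenSeries P y y).norm_mul_pow_le_of_lt_radius hs
  have hi' : 0 < (stepProb P i y x).toReal := ENNReal.toReal_pos hi (stepProb_ne_top _ _ _ _)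
  have hj' : 0 < (stepProb P j x y).toReal := ENNReal.toReal_pos hj (stepProb_ne_top _ _ _ _)
  have hsp : (0 : ℝ) < s := by exact_mod_cast pos_iff_ne_zero.2 hs0
  -- `c` is the weight of the detour from `y` to `x` in `i` steps and back in `j` steps.
  set c : ℝ := (stepProb P i y x).toReal * (stepProb P j x y).toReal * (s : ℝ) ^ (i + j) with hc
  have hcp : 0 < c := by positivity
  refine FormalMultilinearSeries.le_radius_of_bound _ (C / c) fun n => ?_
  rw [le_div_iff₀ hcp]
  refine le_trans ?_ (hb (i + n + j))
  rw [norm_greenSeries, norm_greenSeries]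
  have h : stepProb P i y x * stepProb P n x x * stepProb P j x y ≤ stepProb P (i + n + j) y y :=
    (mul_le_mul_left (stepProb_mul_le P i n y x x) _).trans (stepProb_mul_le P _ _ y x y)
  have h' := ENNReal.toReal_mono (stepProb_ne_top _ _ _ _) h
  rw [ENNReal.toReal_mul, ENNReal.toReal_mul] at h'
  calc (stepProb P n x x).toReal * (s : ℝ) ^ n * c
      = (stepProb P i y x).toReal * (stepProb P n x x).toReal * (stepProb P j x y).toReal *
          (s : ℝ) ^ (i + n + j) := by rw [hc]; ring
    _ ≤ _ := by gcongr

/-- A term exceeding 1 would have unbounded powers, and by supermultiplicativity these bound terms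
of a bounded sequence from below. The constant 1, free of `x`, is what permits a supremum over `x`.
-/
theorem stepProb_mul_pow_le_one (P : X → PMF X) (x : X) {s : ℝ≥0}
    (hs : (s : ℝ≥0∞) < (greenSeries P x x).radius) (n : ℕ) :
    (stepProb P n x x).toReal * (s : ℝ) ^ n ≤ 1 := by
  obtain ⟨C, hC, hb⟩ := (greenSeries P x x).norm_mul_pow_le_of_lt_radius hs
  by_contra! h
  obtain ⟨k, hk⟩ := pow_unbounded_of_one_lt C h
  refine absurd (hb (n * k)) (not_le.2 (hk.trans_le ?_))
  rw [norm_greenSeries, mul_pow, ← pow_mul, ← ENNReal.toReal_pow]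
  gcongr
  · exact stepProb_ne_top _ _ _ _
  · exact stepProb_pow_le P n k x

theorem totallyConvergent_of_one_lt_radius {G : SimpleGraph X} (hconn : G.Connected)
    {P : X → PMF X} (hP : Adapted P G) {x₀ : X} (h : 1 < (greenSeries P x₀ x₀).radius) :
    ReturnSeriesTotallyConvergent P := by
  obtain ⟨s, hs1, hs⟩ := ENNReal.lt_iff_exists_nnreal_btwn.1 h
  have hs1' : 1 < s := by exact_mod_cast hs1
  have hs0 : (s : ℝ) ≠ 0 := by positivity
  -- The available exponent is `n + 1`; one factor `s⁻¹ ≤ 1` is given away.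
  have key : ∀ n, ⨆ x, firstProb P (n + 1) x x ≤ ((s⁻¹ : ℝ≥0) : ℝ≥0∞) ^ n := by
    refine fun n => iSup_le fun x => ?_
    have hx := stepProb_mul_pow_le_one P x (hs.trans_le (radius_le_radius hconn hP x x₀)) (n + 1)
    refine (firstProb_le_stepProb P _ x x).trans ?_
    rw [← ENNReal.ofReal_toReal (stepProb_ne_top P (n + 1) x x), ← ENNReal.coe_pow,
      ← ENNReal.ofReal_coe_nnreal]
    refine ENNReal.ofReal_le_ofReal ?_
    push_cast
    rw [inv_pow, ← one_div, le_div_iff₀ (by positivity)]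
    refine le_trans ?_ hx
    have : (1 : ℝ) ≤ s := by exact_mod_cast hs1'.le
    gcongr
    exact Nat.le_succ n
  refine (ENNReal.tsum_le_tsum key).trans_lt ?_
  rw [ENNReal.tsum_geometric, ENNReal.inv_lt_top, tsub_pos_iff_lt]
  exact_mod_cast inv_lt_one_of_one_lt₀ hs1'

/-! ### Cheeger's inequality -/

open MeasureTheory in
/-- The isoperimetric inequality for sets implies, by integrating over level sets, the
isoperimetric inequality for functions. -/
theorem sum_mul_le_of_isoperimetric [DecidableEq X] {B₀ B : Finset X} {m : X → ℝ}
    {a : X → X → ℝ} (ha : ∀ x y, 0 ≤ a x y) {κ : ℝ} (hκ : 0 ≤ κ)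
    (hiso : ∀ A ⊆ B₀, ∑ x ∈ A, m x ≤ κ * ∑ x ∈ A, ∑ y ∈ B \ A, a x y)
    {h : X → ℝ} (h0 : ∀ x, 0 ≤ h x) (hsupp : ∀ x ∉ B₀, h x = 0) :
    ∑ x ∈ B, m x * h x ≤ κ * ∑ x ∈ B, ∑ y ∈ B, a x y * max (h x - h y) 0 := by
  have hint : ∀ u v c : ℝ, Integrable ((Set.Ico u v).indicator fun _ => c) volume := by
    intro u v c
    rw [integrable_indicator_iff measurableSet_Ico]
    exact integrableOn_const (by simp)
  have hval : ∀ u v c : ℝ, ∫ t, (Set.Ico u v).indicator (fun _ => c) t = c * max (v - u) 0 := by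
    intro u v c
    rw [integral_indicator_const _ measurableSet_Ico]
    simp [mul_comm]
  -- Layer cake: `x` lies in the level set `{t < h}` for `t` in `[0, h x)`, and the pair `(x, y)`
  -- crosses its boundary for `t` in `[h y, h x)`.
  have hl : ∑ x ∈ B, m x * h x =
      ∫ t, ∑ x ∈ B, (Set.Ico 0 (h x)).indicator (fun _ => m x) t := by
    rw [integral_finsetSum _ fun x _ => hint _ _ _]
    refine Finset.sum_congr rfl fun x _ => ?_
    rw [hval, sub_zero, max_eq_left (h0 x)]
  have hr : κ * ∑ x ∈ B, ∑ y ∈ B, a x y * max (h x - h y) 0 =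
      ∫ t, κ * ∑ x ∈ B, ∑ y ∈ B, (Set.Ico (h y) (h x)).indicator (fun _ => a x y) t := by
    rw [integral_const_mul,
      integral_finsetSum _ fun x _ => integrable_finsetSum _ fun y _ => hint _ _ _]
    congr 1
    refine Finset.sum_congr rfl fun x _ => ?_
    rw [integral_finsetSum _ fun x _ => hint _ _ _]
    exact Finset.sum_congr rfl fun y _ => (hval _ _ _).symm
  rw [hl, hr]
  refine integral_mono (integrable_finsetSum _ fun x _ => hint _ _ _)
    ((integrable_finsetSum _ fun x _ => integrable_finsetSum _ fun y _ => hint _ _ _).const_mul κ)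
    fun t => ?_
  rcases lt_or_ge t 0 with ht | ht
  · have h1 : ∑ x ∈ B, (Set.Ico 0 (h x)).indicator (fun _ => m x) t = 0 :=
      Finset.sum_eq_zero fun x _ => Set.indicator_of_notMem (fun hx => ht.not_ge hx.1) _
    simp only [h1]
    exact mul_nonneg hκ (Finset.sum_nonneg fun x _ => Finset.sum_nonneg fun y _ =>
      Set.indicator_nonneg (fun _ _ => ha x y) _)
  · have hA : B.filter (fun x => t < h x) ⊆ B₀ := by
      intro x hx
      by_contra hx0
      rw [Finset.mem_filter, hsupp x hx0] at hx
      exact hx.2.not_ge ht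
    have hiso' := hiso _ hA
    have hs : B \ B.filter (fun x => t < h x) = B.filter (fun x => ¬ t < h x) := by
      ext; simp; tauto
    rw [hs, Finset.sum_filter, Finset.sum_filter] at hiso'
    refine le_of_eq_of_le (Finset.sum_congr rfl fun x _ => ?_)
      (hiso'.trans_eq (congrArg (κ * ·) (Finset.sum_congr rfl fun x _ => ?_)))
    · simp [Set.indicator_apply, ht]
    · by_cases hx : t < h x
      · rw [if_pos hx, Finset.sum_filter]
        simp [Set.indicator_apply, hx]
      · rw [if_neg hx]
        exact (Finset.sum_eq_zero fun y _ => Set.indicator_of_notMem (fun h' => hx h'.2) _).symm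

/-- Apply the functional inequality to `f ^ 2`, factor `f x ^ 2 - f y ^ 2` as a difference times a
sum, and use Cauchy–Schwarz. The two energies are `2N - 2Q` and `2N + 2Q`, so the form is kept away
from `-1` as well as from `1`. -/
theorem cheeger_sq [DecidableEq X] {B₀ B : Finset X} (hB : B₀ ⊆ B) {m : X → ℝ}
    {a : X → X → ℝ} (ha : ∀ x y, 0 ≤ a x y) (hsymm : ∀ x y, a x y = a y x) {κ : ℝ} (hκ : 0 ≤ κ)
    (hiso : ∀ A ⊆ B₀, ∑ x ∈ A, m x ≤ κ * ∑ x ∈ A, ∑ y ∈ B \ A, a x y)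
    (hm : ∀ x, 0 ≤ m x) (hrow : ∀ x ∈ B₀, ∑ y ∈ B, a x y = m x)
    {f : X → ℝ} (hsupp : ∀ x ∉ B₀, f x = 0) :
    (∑ x ∈ B₀, m x * f x ^ 2) ^ 2 ≤ κ ^ 2 * ((∑ x ∈ B₀, m x * f x ^ 2) ^ 2 -
      (∑ x ∈ B₀, ∑ y ∈ B₀, a x y * f x * f y) ^ 2) := by
  have hN : ∑ x ∈ B₀, m x * f x ^ 2 = ∑ x ∈ B, m x * f x ^ 2 :=
    Finset.sum_subset hB fun x _ hx => by simp [hsupp x hx]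
  have hQ : ∑ x ∈ B₀, ∑ y ∈ B₀, a x y * f x * f y = ∑ x ∈ B, ∑ y ∈ B, a x y * f x * f y := by
    rw [← Finset.sum_subset hB fun x _ hx => by simp [hsupp x hx]]
    exact Finset.sum_congr rfl fun x _ =>
      Finset.sum_subset hB fun y _ hy => by simp [hsupp y hy]
  have h1 := sum_mul_le_of_isoperimetric ha hκ hiso (h := fun x => f x ^ 2)
    (fun x => sq_nonneg _) (fun x hx => by simp [hsupp x hx])
  rw [← hN] at h1
  rw [hQ]
  set N := ∑ x ∈ B₀, m x * f x ^ 2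
  set Q := ∑ x ∈ B, ∑ y ∈ B, a x y * f x * f y
  have hL : ∑ x ∈ B, ∑ y ∈ B, a x y * f x ^ 2 = N := by
    rw [hN]
    refine Finset.sum_congr rfl fun x _ => ?_
    by_cases hx : x ∈ B₀
    · rw [← Finset.sum_mul, hrow x hx]
    · simp [hsupp x hx]
  have hR : ∑ x ∈ B, ∑ y ∈ B, a x y * f y ^ 2 = N := by
    rw [Finset.sum_comm, ← hL]
    exact Finset.sum_congr rfl fun x _ => Finset.sum_congr rfl fun y _ => by rw [hsymm]
  have hminus : ∑ x ∈ B, ∑ y ∈ B, a x y * (f x - f y) ^ 2 = 2 * N - 2 * Q := by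
    rw [two_mul N]
    nth_rw 1 [← hL]
    rw [← hR]
    simp only [Q, Finset.mul_sum, ← Finset.sum_add_distrib, ← Finset.sum_sub_distrib]
    exact Finset.sum_congr rfl fun x _ => Finset.sum_congr rfl fun y _ => by ring
  have hplus : ∑ x ∈ B, ∑ y ∈ B, a x y * (f x + f y) ^ 2 = 2 * N + 2 * Q := by
    rw [two_mul N]
    nth_rw 1 [← hL]
    rw [← hR]
    simp only [Q, Finset.mul_sum, ← Finset.sum_add_distrib]
    exact Finset.sum_congr rfl fun x _ => Finset.sum_congr rfl fun y _ => by ring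
  set S := ∑ x ∈ B, ∑ y ∈ B, a x y * max (f x ^ 2 - f y ^ 2) 0
  have hS0 : 0 ≤ S := Finset.sum_nonneg fun x _ => Finset.sum_nonneg fun y _ =>
    mul_nonneg (ha _ _) (le_max_right _ _)
  have hS : ∑ x ∈ B, ∑ y ∈ B, a x y * |f x ^ 2 - f y ^ 2| = 2 * S := by
    have : S = ∑ x ∈ B, ∑ y ∈ B, a x y * max (f y ^ 2 - f x ^ 2) 0 := by
      simp only [S]
      rw [Finset.sum_comm]
      exact Finset.sum_congr rfl fun x _ => Finset.sum_congr rfl fun y _ => by rw [hsymm]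
    rw [two_mul]
    nth_rw 2 [this]
    simp only [S, ← Finset.sum_add_distrib]
    refine Finset.sum_congr rfl fun x _ => Finset.sum_congr rfl fun y _ => ?_
    rw [← mul_add]
    congr 1
    rcases le_total (f x ^ 2) (f y ^ 2) with h | h
    · rw [abs_of_nonpos (by linarith), max_eq_right (by linarith), max_eq_left (by linarith)]
      ring
    · rw [abs_of_nonneg (by linarith), max_eq_left (by linarith), max_eq_right (by linarith)]
      ring
  have hCS : (2 * S) ^ 2 ≤ (2 * N - 2 * Q) * (2 * N + 2 * Q) := by
    rw [← hS, ← hminus, ← hplus, ← Finset.sum_product', ← Finset.sum_product',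
      ← Finset.sum_product']
    refine Finset.sum_sq_le_sum_mul_sum_of_sq_le_mul _
      (fun i _ => mul_nonneg (ha _ _) (sq_nonneg _))
      (fun i _ => mul_nonneg (ha _ _) (sq_nonneg _)) fun i _ => ?_
    rw [mul_pow, sq_abs]
    exact le_of_eq (by ring)
  have hN0 : 0 ≤ N := Finset.sum_nonneg fun x _ => mul_nonneg (hm x) (sq_nonneg _)
  calc N ^ 2 ≤ (κ * S) ^ 2 := by gcongr
    _ = κ ^ 2 * S ^ 2 := by ring
    _ ≤ κ ^ 2 * (N ^ 2 - Q ^ 2) := by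
      gcongr
      linarith

/-- A symmetric form whose numerical range is bounded by `ρ` defines an operator of norm at most
`ρ`. -/
theorem norm_sq_le_of_numericalRange {B₀ : Finset X} {m : X → ℝ}
    {p : X → X → ℝ} (hsymm : ∀ x y, m x * p x y = m y * p y x) {ρ : ℝ} (hρ : 0 < ρ)
    (hnum : ∀ f : X → ℝ, (∀ x ∉ B₀, f x = 0) →
      |∑ x ∈ B₀, ∑ y ∈ B₀, m x * p x y * f x * f y| ≤ ρ * ∑ x ∈ B₀, m x * f x ^ 2)
    {f g : X → ℝ} (hf : ∀ x ∉ B₀, f x = 0) (hg : ∀ x ∉ B₀, g x = 0)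
    (hfg : ∀ x ∈ B₀, f x = ∑ y ∈ B₀, p x y * g y) :
    ∑ x ∈ B₀, m x * f x ^ 2 ≤ ρ ^ 2 * ∑ x ∈ B₀, m x * g x ^ 2 := by
  set F := ∑ x ∈ B₀, m x * f x ^ 2 with hF
  set H := ∑ x ∈ B₀, m x * g x ^ 2 with hH
  have hE1 : ∑ x ∈ B₀, ∑ y ∈ B₀, m x * p x y * f x * g y = F := by
    refine Finset.sum_congr rfl fun x hx => ?_
    have : m x * f x ^ 2 = m x * f x * ∑ y ∈ B₀, p x y * g y := by rw [← hfg x hx]; ring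
    rw [this, Finset.mul_sum]
    exact Finset.sum_congr rfl fun y _ => by ring
  have hE2 : ∑ x ∈ B₀, ∑ y ∈ B₀, m x * p x y * g x * f y = F := by
    rw [← hE1, Finset.sum_comm]
    refine Finset.sum_congr rfl fun x _ => Finset.sum_congr rfl fun y _ => ?_
    rw [hsymm]; ring
  -- Polarization; with the weight `ρ` on `g`, the two bounds add up to `4ρF ≤ ρ(2F + 2ρ²H)`, which
  -- is the claim.
  have h1 := hnum (fun x => f x + ρ * g x) fun x hx => by simp [hf x hx, hg x hx]
  have h2 := hnum (fun x => f x - ρ * g x) fun x hx => by simp [hf x hx, hg x hx]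
  have e1 : ∑ x ∈ B₀, ∑ y ∈ B₀, m x * p x y * (f x + ρ * g x) * (f y + ρ * g y) -
      ∑ x ∈ B₀, ∑ y ∈ B₀, m x * p x y * (f x - ρ * g x) * (f y - ρ * g y) = 4 * ρ * F := by
    have : 4 * ρ * F = 2 * ρ * F + 2 * ρ * F := by ring
    rw [this]
    nth_rw 1 [← hE1]
    rw [← hE2]
    simp only [Finset.mul_sum, ← Finset.sum_add_distrib, ← Finset.sum_sub_distrib]
    exact Finset.sum_congr rfl fun x _ => Finset.sum_congr rfl fun y _ => by ring
  have e2 : ∑ x ∈ B₀, m x * (f x + ρ * g x) ^ 2 + ∑ x ∈ B₀, m x * (f x - ρ * g x) ^ 2 =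
      2 * F + 2 * ρ ^ 2 * H := by
    simp only [hF, hH, Finset.mul_sum, ← Finset.sum_add_distrib]
    exact Finset.sum_congr rfl fun x _ => by ring
  have h3 := (abs_le.1 h1).2
  have h4 := (abs_le.1 h2).1
  have h5 : 4 * ρ * F ≤ ρ * (2 * F + 2 * ρ ^ 2 * H) := by rw [← e1, ← e2]; linarith
  have h6 : ρ * (2 * F) ≤ ρ * (2 * (ρ ^ 2 * H)) := by linarith
  linarith [le_of_mul_le_mul_left h6 hρ]

/-! ### Spectral consequences of the strong isoperimetric inequality -/

theorem Adapted.symm {G : SimpleGraph X} {P : X → PMF X} (hP : Adapted P G) {x y : X}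
    (h : P x y ≠ 0) : P y x ≠ 0 := by
  by_cases hxy : x = y
  · rwa [hxy] at h ⊢
  · exact ((hP y x (Ne.symm hxy)).2 ((hP x y hxy).1 (pos_iff_ne_zero.2 h)).symm).ne'

theorem Adapted.finite_support {G : SimpleGraph X} (hfin : ∀ x : X, (G.neighborSet x).Finite)
    {P : X → PMF X} (hP : Adapted P G) (x : X) : (P x).support.Finite := by
  refine ((hfin x).insert x).subset fun y hy => ?_
  by_cases hxy : x = y
  · exact Or.inl hxy.symm
  · exact Or.inr ((hP x y hxy).1 (pos_iff_ne_zero.2 hy))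

theorem finite_setOf_stepProb_ne_zero {G : SimpleGraph X}
    (hfin : ∀ x : X, (G.neighborSet x).Finite) {P : X → PMF X} (hP : Adapted P G) (n : ℕ) (y : X) :
    {x | stepProb P n x y ≠ 0}.Finite := by
  classical
  induction n with
  | zero =>
    refine (Set.finite_singleton y).subset fun x hx => ?_
    by_contra hxy
    exact hx (by rw [stepProb_zero]; exact if_neg hxy)
  | succ n ih =>
    refine (ih.biUnion fun z _ => hP.finite_support hfin z).subset fun x hx => ?_
    rw [Set.mem_ofPred_eq, stepProb_succ] at hx
    have : ∃ z, P x z * stepProb P n z y ≠ 0 := by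
      by_contra! h
      exact hx (ENNReal.tsum_eq_zero.2 h)
    obtain ⟨z, hz⟩ := this
    exact Set.mem_biUnion (right_ne_zero_of_mul hz) (hP.symm (left_ne_zero_of_mul hz))

theorem sum_toReal_eq_one (P : X → PMF X) {x : X} {B : Finset X}
    (hB : ∀ y ∉ B, P x y = 0) : ∑ y ∈ B, (P x y).toReal = 1 := by
  have h : ∑' y, P x y = ∑ y ∈ B, P x y := tsum_eq_sum hB
  rw [← ENNReal.toReal_sum fun y _ => (P x).apply_ne_top y, ← h, (P x).tsum_coe,
    ENNReal.toReal_one]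

theorem toReal_stepProb_succ (P : X → PMF X) (n : ℕ) (x y : X) {B : Finset X}
    (hB : ∀ z ∉ B, stepProb P n z y = 0) :
    (stepProb P (n + 1) x y).toReal =
      ∑ z ∈ B, (P x z).toReal * (stepProb P n z y).toReal := by
  rw [stepProb_succ, tsum_eq_sum fun z hz => by rw [hB z hz, mul_zero],
    ENNReal.toReal_sum fun z _ =>
      ENNReal.mul_ne_top ((P x).apply_ne_top z) (stepProb_ne_top P n z y)]
  exact Finset.sum_congr rfl fun z _ => ENNReal.toReal_mul

theorem boundaryWeight_eq_ofReal [DecidableEq X] (P : X → PMF X) (m : X → ℝ≥0) {A B : Finset X}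
    (hB : ∀ x ∈ A, ∀ y ∉ B, P x y = 0) :
    boundaryWeight P m A =
      ENNReal.ofReal (∑ x ∈ A, ∑ y ∈ B \ A, (m x : ℝ) * (P x y).toReal) := by
  unfold boundaryWeight
  have h0 : ∀ x y, 0 ≤ (m x : ℝ) * (P x y).toReal := fun x y => by positivity
  rw [ENNReal.ofReal_sum_of_nonneg fun x _ => Finset.sum_nonneg fun y _ => h0 x y]
  refine Finset.sum_congr rfl fun x hx => ?_
  rw [ENNReal.ofReal_sum_of_nonneg fun y _ => h0 x y]
  have h1 : ∑' y : {y : X // y ∉ A}, conductance P m x y =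
      ∑' y, ({y | y ∉ A} : Set X).indicator (conductance P m x) y :=
    tsum_subtype {y | y ∉ A} (conductance P m x)
  rw [h1, tsum_eq_sum (s := B \ A)]
  · refine Finset.sum_congr rfl fun y hy => ?_
    rw [Set.indicator_of_mem (by exact (Finset.mem_sdiff.1 hy).2), conductance,
      ENNReal.ofReal_mul (m x).coe_nonneg, ENNReal.ofReal_coe_nnreal,
      ENNReal.ofReal_toReal ((P x).apply_ne_top y)]
  · intro y hy
    by_cases hyA : y ∈ A
    · exact Set.indicator_of_notMem (by simpa using hyA) _
    · have : y ∉ B := fun h => hy (Finset.mem_sdiff.2 ⟨h, hyA⟩)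
      rw [Set.indicator_of_mem (by exact hyA), conductance, hB x hx y this, mul_zero]

theorem StrongIsoperimetric.exists_bound {P : X → PMF X} {m : X → ℝ≥0}
    (h : StrongIsoperimetric P m) : ∃ κ : ℝ, 1 < κ ∧ ∀ A : Finset X,
      ∑ x ∈ A, (m x : ℝ≥0∞) ≤ ENNReal.ofReal κ * boundaryWeight P m A := by
  set K := ⨆ A : Finset X, (∑ x ∈ A, (m x : ℝ≥0∞)) / boundaryWeight P m A
  -- The summand 2 ensures `κ > 1`, so that `1 - κ⁻²` is positive.
  refine ⟨K.toReal + 2, by linarith [K.toReal_nonneg], fun A => ?_⟩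
  have hKle : K ≤ ENNReal.ofReal (K.toReal + 2) := by
    have hK : K ≠ ⊤ := LT.lt.ne h
    exact (ENNReal.ofReal_toReal hK).ge.trans (ENNReal.ofReal_le_ofReal (by linarith))
  refine (ENNReal.div_le_iff_le_mul (Or.inr ENNReal.ofReal_ne_top) (Or.inr ?_)).1
    ((le_iSup (fun A : Finset X => (∑ x ∈ A, (m x : ℝ≥0∞)) / boundaryWeight P m A) A).trans hKle)
  exact (ENNReal.ofReal_pos.2 (by linarith [K.toReal_nonneg])).ne'

/-- Cheeger's inequality: under the strong isoperimetric inequality the numerical range of `P`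
on finitely supported functions is bounded away from `±1`. -/
theorem exists_numericalRange_bound {G : SimpleGraph X}
    (hfin : ∀ x : X, (G.neighborSet x).Finite) {P : X → PMF X} (hP : Adapted P G) {m : X → ℝ≥0}
    (hm : IsReversibilityMeasure P m) (hiso : StrongIsoperimetric P m) :
    ∃ ρ : ℝ, 0 < ρ ∧ ρ < 1 ∧ ∀ (B₀ : Finset X) (f : X → ℝ), (∀ x ∉ B₀, f x = 0) →
      |∑ x ∈ B₀, ∑ y ∈ B₀, (m x : ℝ) * (P x y).toReal * f x * f y| ≤
        ρ * ∑ x ∈ B₀, (m x : ℝ) * f x ^ 2 := by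
  classical
  obtain ⟨κ, hκ, hbound⟩ := hiso.exists_bound
  have hκ0 : 0 < κ := by linarith
  have hinv : (κ ^ 2)⁻¹ < 1 := inv_lt_one_of_one_lt₀ (one_lt_pow₀ hκ two_ne_zero)
  have hinv0 : 0 < (κ ^ 2)⁻¹ := by positivity
  -- `N² ≤ κ²(N² - Q²)` rearranges to `Q² ≤ (1 - κ⁻²)N²`.
  refine ⟨√(1 - (κ ^ 2)⁻¹), Real.sqrt_pos.2 (by linarith),
    (Real.sqrt_lt' one_pos).2 (by linarith), fun B₀ f hf => ?_⟩
  -- Adding all one-step successors makes the rows over `B₀` complete inside `B`, with sum `m x`,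
  -- and loses no boundary weight.
  set B := B₀ ∪ B₀.biUnion fun x => (hP.finite_support hfin x).toFinset
  have hB : ∀ x ∈ B₀, ∀ y ∉ B, P x y = 0 := by
    intro x hx y hy
    by_contra h
    exact hy (Finset.mem_union_right _ (Finset.mem_biUnion.2
      ⟨x, hx, (hP.finite_support hfin x).mem_toFinset.2 ((P x).mem_support_iff y |>.2 h)⟩))
  have hsymm : ∀ x y, (m x : ℝ) * (P x y).toReal = m y * (P y x).toReal := by
    intro x y
    simpa [conductance, ENNReal.toReal_mul] using congrArg ENNReal.toReal (hm.2 x y)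
  have hch := cheeger_sq (m := fun x => (m x : ℝ)) (a := fun x y => (m x : ℝ) * (P x y).toReal)
    (Finset.subset_union_left : B₀ ⊆ B) (fun x y => by positivity) hsymm hκ0.le
    (fun A hA => by
      have h := hbound A
      rw [boundaryWeight_eq_ofReal P m (B := B) fun x hx => hB x (hA hx),
        ← ENNReal.ofReal_mul hκ0.le,
        ← ENNReal.ofNNReal_finsetSum, ← ENNReal.ofReal_coe_nnreal] at h
      have h0 : 0 ≤ κ * ∑ x ∈ A, ∑ y ∈ B \ A, (m x : ℝ) * (P x y).toReal := by positivity
      simpa using (ENNReal.ofReal_le_ofReal_iff h0).1 h)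
    (fun x => (m x).coe_nonneg)
    (fun x hx => by rw [← Finset.mul_sum, sum_toReal_eq_one P (hB x hx), mul_one]) hf
  have hN : 0 ≤ ∑ x ∈ B₀, (m x : ℝ) * f x ^ 2 := by positivity
  refine abs_le_of_sq_le_sq ?_ (by positivity)
  rw [mul_pow, Real.sq_sqrt (by linarith)]
  have hk2 : 0 < κ ^ 2 := by positivity
  have := (inv_mul_le_iff₀ hk2).2 hch
  linarith

/-- The functions `p^(k)(·,x₀)` are the iterates of `P` on the point mass at `x₀`. Each step shrinks
the `m`-weighted ℓ² norm by `ρ`, and the value at `x₀` is one term of that norm. -/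
theorem toReal_stepProb_le_pow {G : SimpleGraph X}
    (hfin : ∀ x : X, (G.neighborSet x).Finite) {P : X → PMF X} (hP : Adapted P G) {m : X → ℝ≥0}
    (hm : IsReversibilityMeasure P m) {ρ : ℝ} (hρ : 0 < ρ)
    (hnum : ∀ (B₀ : Finset X) (f : X → ℝ), (∀ x ∉ B₀, f x = 0) →
      |∑ x ∈ B₀, ∑ y ∈ B₀, (m x : ℝ) * (P x y).toReal * f x * f y| ≤
        ρ * ∑ x ∈ B₀, (m x : ℝ) * f x ^ 2) (n : ℕ) (x₀ : X) :
    (stepProb P n x₀ x₀).toReal ≤ ρ ^ n := by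
  classical
  set g : ℕ → X → ℝ := fun k x => (stepProb P k x x₀).toReal
  -- `B₀` contains the supports of all iterates up to time `n`, so restricting `P` to `B₀` does not
  -- alter them there.
  set B₀ := insert x₀ ((Finset.range (n + 1)).biUnion fun k =>
    (finite_setOf_stepProb_ne_zero hfin hP k x₀).toFinset)
  have hB : ∀ k ≤ n, ∀ x ∉ B₀, stepProb P k x x₀ = 0 := by
    intro k hk x hx
    by_contra h
    exact hx (Finset.mem_insert_of_mem (Finset.mem_biUnion.2
      ⟨k, Finset.mem_range.2 (by omega), (Set.Finite.mem_toFinset _).2 h⟩))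
  have hg : ∀ k ≤ n, ∀ x ∉ B₀, g k x = 0 := fun k hk x hx => by simp [g, hB k hk x hx]
  have hsymm : ∀ x y, (m x : ℝ) * (P x y).toReal = m y * (P y x).toReal := by
    intro x y
    simpa [conductance, ENNReal.toReal_mul] using congrArg ENNReal.toReal (hm.2 x y)
  have hx₀ : x₀ ∈ B₀ := Finset.mem_insert_self _ _
  have hstep : ∀ k ≤ n, ∑ x ∈ B₀, (m x : ℝ) * g k x ^ 2 ≤ (ρ ^ k) ^ 2 * m x₀ := by
    intro k
    induction k with
    | zero =>
      intro _
      rw [Finset.sum_eq_single_of_mem x₀ hx₀ fun x _ hx => by simp [g, stepProb_zero, hx]]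
      simp [g, stepProb_zero]
    | succ k ih =>
      intro hk
      calc _ ≤ ρ ^ 2 * ∑ x ∈ B₀, (m x : ℝ) * g k x ^ 2 :=
            norm_sq_le_of_numericalRange hsymm hρ (hnum B₀) (hg _ hk) (hg _ (by omega))
              fun x _ => toReal_stepProb_succ P k x x₀ (hB k (by omega))
        _ ≤ ρ ^ 2 * ((ρ ^ k) ^ 2 * m x₀) := by gcongr; exact ih (by omega)
        _ = _ := by ring
  have hm0 : (0 : ℝ) < m x₀ := hm.1 x₀
  have h1 : (m x₀ : ℝ) * g n x₀ ^ 2 ≤ (ρ ^ n) ^ 2 * m x₀ :=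
    (Finset.single_le_sum (f := fun x => (m x : ℝ) * g n x ^ 2)
      (fun x _ => by positivity) hx₀).trans (hstep n le_rfl)
  rw [mul_comm] at h1
  exact le_of_sq_le_sq (le_of_mul_le_mul_right h1 hm0) (by positivity)

theorem one_lt_radius_of_strongIsoperimetric {G : SimpleGraph X}
    (hfin : ∀ x : X, (G.neighborSet x).Finite) {P : X → PMF X} (hP : Adapted P G) {m : X → ℝ≥0}
    (hm : IsReversibilityMeasure P m) (hiso : StrongIsoperimetric P m) (x : X) :
    1 < (greenSeries P x x).radius := by
  obtain ⟨ρ, hρ0, hρ1, hnum⟩ := exists_numericalRange_bound hfin hP hm hiso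
  lift ρ to ℝ≥0 using hρ0.le
  have hρ0' : ρ ≠ 0 := by rintro rfl; simp at hρ0
  have h1 : (1 : ℝ≥0∞) < (ρ⁻¹ : ℝ≥0) := by
    exact_mod_cast (one_lt_inv₀ (pos_iff_ne_zero.2 hρ0')).2 (by exact_mod_cast hρ1)
  refine h1.trans_le (FormalMultilinearSeries.le_radius_of_bound _ 1 fun n => ?_)
  rw [norm_greenSeries]
  calc _ ≤ (ρ : ℝ) ^ n * ((ρ⁻¹ : ℝ≥0) : ℝ) ^ n := by
        gcongr; exact toReal_stepProb_le_pow hfin hP hm hρ0 hnum n x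
    _ = 1 := by
        rw [← mul_pow, NNReal.coe_inv, mul_inv_cancel₀ hρ0.ne', one_pow]

end GraphWalk

theorem mainTheorem10 {X : Type*} (G : SimpleGraph X) (hconn : G.Connected)
    (hfin : ∀ x : X, (G.neighborSet x).Finite)
    (P : X → PMF X) (hP : GraphWalk.Adapted P G) :
    (∀ x y : X, (GraphWalk.greenSeries P x x).radius = (GraphWalk.greenSeries P y y).radius) ∧
    (((∃ (Γ : Set (G ≃g G)) (X₀ : Set X), X₀.Finite ∧
          (∀ y : X, ∃ x ∈ X₀, ∃ γ ∈ Γ, γ x = y) ∧ GraphWalk.Invariant P Γ) ∨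
        (∃ x : X, 1 < (GraphWalk.greenSeries P x x).radius) ∨
        (∃ m : X → ℝ≥0, GraphWalk.IsReversibilityMeasure P m ∧
          GraphWalk.StrongIsoperimetric P m)) →
      GraphWalk.ReturnSeriesTotallyConvergent P) := by
  refine ⟨fun x y => le_antisymm (GraphWalk.radius_le_radius hconn hP y x)
    (GraphWalk.radius_le_radius hconn hP x y), ?_⟩
  rintro (⟨Γ, X₀, hX₀, hcov, hΓ⟩ | ⟨x, hx⟩ | ⟨m, hm, hiso⟩)
  · exact GraphWalk.totallyConvergent_of_invariant hX₀ hcov hΓ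
  · exact GraphWalk.totallyConvergent_of_one_lt_radius hconn hP hx
  · obtain ⟨x⟩ := hconn.nonempty
    exact GraphWalk.totallyConvergent_of_one_lt_radius hconn hP
      (GraphWalk.one_lt_radius_of_strongIsoperimetric hfin hP hm hiso x)
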